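/- Cascade bandit model. There are $K$ arms with parameters $\mu_i\in(0,1]$ and error probabilities $0\le p_1<p_2<\dots<p_K\le 1$; put $\Delta_i=p_i-p_{i-1}$ for $2\le i\le K$. In slot $t=1,2,\dots$ arm $i$ has an output $X_i(t)\in\{0,1\}$ with $\mathbb P(X_i(t)=1)=\mu_i$ and a feedback $Y_i(t)\in\{0,1\}$ with $\mathbb P(Y_i(t)=0\mid X_i(t)=1)=p_i$; the pairs $(X_i(t),Y_i(t))$ are independent over all $i$ and $t$. In slot $t$ the learner chooses an ordering $\mathcal L_t=(l_1,\dots,l_K)$ of the arms; the first arm in this ordering whose output is $1$ (if any) is displayed, and its feedback is observed. The expected reward of an ordering is $r_{\mathcal L}=\sum_{j=1}^K(1-p_{l_j})\mu_{l_j}\prod_{m<j}(1-\mu_{l_m})$, the optimal ordering is $\mathcal L^*=(1,2,\dots,K)$, and the regret up to time $T$ is $\mathcal R(T)=\sum_{t=1}^T\mathbb E[r_{\mathcal L^*}-r_{\mathcal L_t}]$. Explore-and-Commit with horizon $T\ge 1$. Let $N=\max_{2\le i\le K}\lceil 16\log T/(\Delta_i^2\mu_i)\rceil$ (and $N=0$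 if there is no such $i$). The initial ordering is random (with any law), independent of all $X_i(t),Y_i(t)$. In each of the $NK$ exploration slots the current ordering is used and then rotated, $(l_1,\dots,l_K)\mapsto(l_2,\dots,l_K,l_1)$. After them, let $S_i$ be the number of exploration slots in which arm $i$ was displayed, $\hat p_i$ the fraction of these with feedback $0$, and $L_i=\hat p_i-\sqrt{2\log T/S_i}$ (with $L_i=-\infty$ if $S_i=0$). The algorithm commits to an ordering $\mathcal L'$ listing the arms in ascending order of $L_i$ (ties broken in any way) and uses it in all later slots. Theorem. The committed ordering satisfies $$\mathbb P(\mathcal L'\ne\mathcal L^*)\le \frac{K}{T^2}+\frac{K^2}{T^4},$$ and the regret of Explore-and-Commit satisfies $\mathcal R^{EC}(T)=O(\log T)$: there is a constant $C$ depending only on $K$, $(\mu_i)$ and $(p_i)$ such that $|\mathcal R^{EC}(T)|\le C\log T$ for all $T\ge 2$. -/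

import Mathlib

open MeasureTheory ProbabilityTheory

noncomputable section

namespace CascadeBandit

/-- An ordering of `K` arms: `σ j` is the arm placed at position `j` of the cascade
(arms and positions are counted from `0`). -/
abbrev ArmOrder (K : ℕ) : Type := Equiv.Perm (Fin K)

/-- The finite set of orderings carries the discrete sigma-algebra. -/
instance instMeasurableSpaceArmOrder (K : ℕ) : MeasurableSpace (ArmOrder K) := ⊤

/-- Expected one-slot reward of the ordering `σ`:
`∑ j, (1 - p (σ j)) * μ (σ j) * ∏ i < j, (1 - μ (σ i))`. -/
def expectedReward {K : ℕ} (μ p : Fin K → ℝ) (σ : ArmOrder K) : ℝ :=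
  ∑ j : Fin K, (1 - p (σ j)) * μ (σ j) * ∏ i ∈ Finset.Iio j, (1 - μ (σ i))

/-- The optimal ordering sorts the arms by increasing error probability. As the arms are indexed so
that the error probabilities are strictly increasing, it is the identity ordering. -/
def optOrder (K : ℕ) : ArmOrder K := 1

/-- The gap `p i - p (i - 1)` between consecutive arms; meaningful (and used) for all arms but the
first one only. -/
def gap {K : ℕ} (p : Fin K → ℝ) (i : Fin K) : ℝ :=
  p i - p ⟨(i : ℕ) - 1, lt_of_le_of_lt (Nat.sub_le _ _) i.isLt⟩

/-- The number `N` of exploration rounds per arm: the maximum, over all arms `i` but the first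
one, of `⌈16 log T / (Δ_i ^ 2 μ_i)⌉`. -/
def exploreRounds {K : ℕ} (μ p : Fin K → ℝ) (T : ℕ) : ℕ :=
  (Finset.univ.filter fun i : Fin K => 0 < (i : ℕ)).sup
    fun i => ⌈16 * Real.log T / (gap p i ^ 2 * μ i)⌉₊

/-- The stochastic environment. In slot `t` (slots are counted from `0`) arm `i` outputs `X t i`,
a Bernoulli variable of mean `μ i`; the user's feedback to arm `i`, if it is displayed, is `Y t i`,
and `P (Y t i = 0 | X t i = 1) = p i`. The pairs `(X t i, Y t i)` are independent over all slots
and all arms. -/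
structure IsEnvironment {K : ℕ} {Ω : Type*} [MeasurableSpace Ω] (P : Measure Ω)
    (μ p : Fin K → ℝ) (X Y : ℕ → Fin K → Ω → Bool) : Prop where
  measurable_output : ∀ t i, Measurable (X t i)
  measurable_feedback : ∀ t i, Measurable (Y t i)
  prob_output : ∀ t i, P {ω | X t i ω = true} = ENNReal.ofReal (μ i)
  prob_error : ∀ t i, P[{ω | Y t i ω = false} | {ω | X t i ω = true}] = ENNReal.ofReal (p i)
  indep : iIndepFun (fun (q : ℕ × Fin K) ω => (X q.1 q.2 ω, Y q.1 q.2 ω)) P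

/-- With ordering `σ` and outputs `x`, the cascade displays arm `i`: it outputs one, and all the
arms placed before it output zero. -/
def Displays {K : ℕ} (σ : ArmOrder K) (x : Fin K → Bool) (i : Fin K) : Prop :=
  x i = true ∧ ∀ j, j < σ.symm i → x (σ j) = false

/-- The ordering used in exploration slot `t`, for the initial ordering `σ`: after every slot the
ordering `(l_1, l_2, …, l_K)` is replaced by `(l_2, …, l_K, l_1)`. -/
def exploreOrder {K : ℕ} (σ : ArmOrder K) : ℕ → ArmOrder K
  | 0 => σ
  | t + 1 => (finRotate K).trans (exploreOrder σ t)

section Statistics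

variable {K : ℕ} {Ω : Type*}

open Classical in
/-- `S_i`: how often arm `i` is displayed in the first `n` exploration slots. -/
def displayCount (X : ℕ → Fin K → Ω → Bool) (σ : ArmOrder K) (n : ℕ) (i : Fin K) (ω : Ω) : ℕ :=
  ((Finset.range n).filter fun t => Displays (exploreOrder σ t) (fun k => X t k ω) i).card

open Classical in
/-- How often arm `i` is displayed with feedback zero in the first `n` exploration slots. -/
def errorCount (X Y : ℕ → Fin K → Ω → Bool) (σ : ArmOrder K) (n : ℕ) (i : Fin K) (ω : Ω) : ℕ :=
  ((Finset.range n).filter fun t =>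
    Displays (exploreOrder σ t) (fun k => X t k ω) i ∧ Y t i ω = false).card

/-- The lower confidence bound `p̂_i - √(2 log T / S_i)` of arm `i` after `n` exploration slots,
where `p̂_i` is the empirical error probability; it is `-∞` for an arm that has never been
displayed, whose confidence radius is infinite. -/
def lcb (X Y : ℕ → Fin K → Ω → Bool) (T : ℕ) (σ : ArmOrder K) (n : ℕ) (i : Fin K) (ω : Ω) :
    EReal :=
  if displayCount X σ n i ω = 0 then ⊥
  else (((errorCount X Y σ n i ω : ℝ) / (displayCount X σ n i ω : ℝ)
    - √(2 * Real.log T / (displayCount X σ n i ω : ℝ)) : ℝ) : EReal)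

end Statistics

/-- A run of Explore-and-Commit with horizon `T`: `init` is the random initial ordering (of any
law), independent of the environment, and `commit` is the ordering committed to, which lists the
arms in ascending order of their lower confidence bounds after the `N * K` exploration slots
(ties may be broken in any way). -/
structure IsECRun {K : ℕ} {Ω : Type*} [MeasurableSpace Ω] (P : Measure Ω) (μ p : Fin K → ℝ)
    (X Y : ℕ → Fin K → Ω → Bool) (T : ℕ) (init commit : Ω → ArmOrder K) : Prop where
  measurable_init : Measurable init
  measurable_commit : Measurable commit
  indep_init : IndepFun init (fun ω (q : ℕ × Fin K) => (X q.1 q.2 ω, Y q.1 q.2 ω)) P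
  ascending : ∀ ω,
    Monotone fun j => lcb X Y T (init ω) (exploreRounds μ p T * K) (commit ω j) ω

/-- The ordering that Explore-and-Commit uses in slot `t`: the rotated initial ordering during the
`N * K` exploration slots, and the committed ordering afterwards. -/
def ecOrder {K : ℕ} {Ω : Type*} (μ p : Fin K → ℝ) (T : ℕ) (init commit : Ω → ArmOrder K)
    (t : ℕ) (ω : Ω) : ArmOrder K :=
  if t < exploreRounds μ p T * K then exploreOrder (init ω) t else commit ω

/-- The expected regret, over the slots `0, …, T - 1`, of the policy that uses the random ordering
`L t` in slot `t`. -/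
def regret {K : ℕ} {Ω : Type*} [MeasurableSpace Ω] (P : Measure Ω) (μ p : Fin K → ℝ)
    (L : ℕ → Ω → ArmOrder K) (T : ℕ) : ℝ :=
  ∑ t ∈ Finset.range T, ∫ ω, (expectedReward μ p (optOrder K) - expectedReward μ p (L t ω)) ∂P

end CascadeBandit

end

noncomputable section

namespace CascadeBandit

/-! Call an arm misleading if it is displayed at most `N μ i / 2` times (first arm exempt), or if
its error count violates the confidence bound on either side. If no arm is misleading, every LCB is
at most `p i`. For a later arm `j`, more than `8 log T / gap²` displays make the radius less than
`gap / 2`, so its LCB exceeds `p j - gap p j`, the error probability of the preceding arm. The LCBs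
therefore increase strictly and the committed permutation is the identity.

Each arm is in front `N` times, so a Chernoff bound (`hits_lower_tail`) makes scarcity cost at most
`T⁻²`. The number of displays is random, but given the set of display slots the errors are
independent with probability `p i`: the arms in front affect only whether `i` is displayed. Applying
Hoeffding for each display set and averaging (`marks_upper_tail`, `marks_lower_tail`) costs `T⁻⁴`
per side, with no union bound over the number of displays. These bounds hold for each fixed initial
ordering, and independence transfers them to a random one.

The regret is a constant per exploration slot, `O(log T)` in all, plus at most a constant times `T`
times the failure probability, which is bounded. -/

/-- Hoeffding's lemma for a Bernoulli variable of mean `q`. -/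
theorem bernoulli_mgf_le {q : ℝ} (h0 : 0 ≤ q) (h1 : q ≤ 1) (s : ℝ) :
    q * Real.exp (s * (1 - q)) + (1 - q) * Real.exp (-(s * q)) ≤ Real.exp (s ^ 2 / 8) := by
  have h1' : 0 ≤ 1 - q := by linarith
  set ν : Measure ℝ := ENNReal.ofReal q • Measure.dirac 1 + ENNReal.ofReal (1 - q) • Measure.dirac 0
    with hν
  have : IsProbabilityMeasure ν := by
    constructor
    simp [hν, ← ENNReal.ofReal_add h0 h1']
  have hint : ∀ g : ℝ → ℝ, ∫ x, g x ∂ν = q * g 1 + (1 - q) * g 0 := by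
    intro g
    have hi : ∀ a : ℝ, ∀ c : ℝ, Integrable g (ENNReal.ofReal c • Measure.dirac a) := fun a c =>
      (integrable_dirac (by simp)).smul_measure ENNReal.ofReal_ne_top
    rw [hν, integral_add_measure (hi _ _) (hi _ _), integral_smul_measure, integral_smul_measure,
      integral_dirac, integral_dirac, ENNReal.toReal_ofReal h0, ENNReal.toReal_ofReal h1']
    simp
  have hb : ∀ᵐ x ∂ν, id x ∈ Set.Icc (0 : ℝ) 1 := by
    rw [hν, ae_add_measure_iff]
    constructor <;> refine Measure.ae_smul_measure ?_ _ <;> simp [ae_dirac_eq]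
  -- The two-point law `ν` lives on an interval of length 1, so its variance proxy is 1/4 and the
  -- exponent is `s² / 8`.
  have := (hasSubgaussianMGF_of_mem_Icc (μ := ν) (X := id) (a := 0) (b := 1)
    aemeasurable_id hb).mgf_le s
  rw [mgf, hint, hint] at this
  simp only [id, mul_one, mul_zero, add_zero, zero_sub, mul_neg] at this
  refine this.trans (le_of_eq ?_)
  congr 1
  simp
  ring

/-! ### Tail bounds for counts over independent trials. -/

section Counting

variable {Ω ι : Type*} [Fintype ι]

/-- The number of trials `t` in which the first component of `f t` is `true`. -/
def hits (f : ι → Ω → Bool × Bool) (ω : Ω) : ℕ :=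
  (Finset.univ.filter fun t => (f t ω).1 = true).card

/-- The number of trials `t` in which both components of `f t` are `true`. -/
def marks (f : ι → Ω → Bool × Bool) (ω : Ω) : ℕ :=
  (Finset.univ.filter fun t => (f t ω).1 = true ∧ (f t ω).2 = true).card

variable [MeasurableSpace Ω]

theorem integral_prod_comp_of_finite {P : Measure Ω} {α : Type*} [Finite α] [MeasurableSpace α]
    [MeasurableSingletonClass α] {f : ι → Ω → α} (hf : ∀ t, Measurable (f t))
    (hi : iIndepFun f P) (g : ι → α → ℝ) :
    ∫ ω, ∏ t, g t (f t ω) ∂P = ∏ t, ∫ ω, g t (f t ω) ∂P :=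
  hi.integral_fun_prod_comp (fun t => (hf t).aemeasurable)
    fun t => (measurable_of_finite (g t)).aestronglyMeasurable

variable {P : Measure Ω} [IsProbabilityMeasure P]

theorem integrable_comp_of_finite {α : Type*} [Finite α] [MeasurableSpace α]
    [MeasurableSingletonClass α] {f : Ω → α} (hf : Measurable f) (g : α → ℝ) :
    Integrable (fun ω => g (f ω)) P := by
  have hm : Measurable g := measurable_of_finite g
  obtain ⟨C, hC⟩ := (Set.finite_range fun a => ‖g a‖).bddAbove
  exact Integrable.of_bound (hm.comp hf).aestronglyMeasurable C
    (Filter.Eventually.of_forall fun ω => hC ⟨f ω, rfl⟩)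

theorem integrable_prod_comp_of_finite {α : Type*} [Finite α] [MeasurableSpace α]
    [MeasurableSingletonClass α] {f : ι → Ω → α} (hf : ∀ t, Measurable (f t))
    (g : ι → α → ℝ) : Integrable (fun ω => ∏ t, g t (f t ω)) P :=
  integrable_comp_of_finite (f := fun ω t => f t ω) (measurable_pi_iff.2 hf)
    fun x => ∏ t, g t (x t)

/-- Markov's inequality, in the form used for both exponential-moment bounds. -/
theorem measureReal_le_integral {A : Set Ω} (hA : MeasurableSet A) {g : Ω → ℝ}
    (hg : Integrable g P) (h0 : ∀ ω, 0 ≤ g ω) (h1 : ∀ ω ∈ A, 1 ≤ g ω) :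
    P.real A ≤ ∫ ω, g ω ∂P := by
  rw [← integral_indicator_one hA]
  refine integral_mono ((integrable_const 1).indicator hA) hg fun ω => ?_
  by_cases h : ω ∈ A
  · simpa [h] using h1 ω h
  · simpa [h] using h0 ω

theorem measurable_hits {f : ι → Ω → Bool × Bool} (hf : ∀ t, Measurable (f t)) :
    Measurable (hits f) :=
  (measurable_of_finite fun x : ι → Bool × Bool =>
    (Finset.univ.filter fun t => (x t).1 = true).card).comp (measurable_pi_iff.2 hf)

theorem measurable_marks {f : ι → Ω → Bool × Bool} (hf : ∀ t, Measurable (f t)) :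
    Measurable (marks f) :=
  (measurable_of_finite fun x : ι → Bool × Bool =>
    (Finset.univ.filter fun t => (x t).1 = true ∧ (x t).2 = true).card).comp (measurable_pi_iff.2 hf)

/-- Lower tail of the number of hits (a Chernoff bound). -/
theorem hits_lower_tail {f : ι → Ω → Bool × Bool} (hf : ∀ t, Measurable (f t))
    (hi : iIndepFun f P) {m : ℝ} (hm0 : 0 ≤ m)
    (hm : m ≤ ∑ t, P.real {ω | (f t ω).1 = true}) :
    P.real {ω | (hits f ω : ℝ) ≤ m / 2} ≤ Real.exp (-(m / 8)) := by
  have hS : ∀ t, MeasurableSet {ω | (f t ω).1 = true} := fun t =>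
    (measurable_fst.comp (hf t)) (measurableSet_singleton true)
  -- The Chernoff parameter is `-log 2`: the product of these factors is `2 ^ (-hits)`.
  let g : ι → Bool × Bool → ℝ := fun _ x => if x.1 = true then 1 / 2 else 1
  have hg : ∀ ω, ∏ t, g t (f t ω) = Real.exp (-(Real.log 2 * hits f ω)) := by
    intro ω
    simp only [g, Finset.prod_ite, Finset.prod_const]
    rw [Real.exp_neg, Real.exp_mul, Real.exp_log two_pos, Real.rpow_natCast]
    simp [hits]
  have hE : ∀ t, ∫ ω, g t (f t ω) ∂P ≤ Real.exp (-(P.real {ω | (f t ω).1 = true} / 2)) := by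
    intro t
    have : ∀ ω, g t (f t ω) = 1 - ({ω | (f t ω).1 = true}.indicator 1 ω : ℝ) * (1 / 2) := by
      intro ω
      by_cases h : (f t ω).1 = true <;> simp [g, h]
      norm_num
    simp_rw [this]
    rw [integral_sub (integrable_const _) (((integrable_const 1).indicator (hS t)).mul_const _),
      integral_mul_const, integral_indicator_one (hS t)]
    have := Real.add_one_le_exp (-(P.real {ω | (f t ω).1 = true} / 2))
    simp only [integral_const, probReal_univ, smul_eq_mul]
    linarith
  -- The final exponent is `(log 2 - 1) * m / 2`, which this makes at most `-m / 8`.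
  have hlog : Real.log 2 < 3 / 4 := by linarith [Real.log_two_lt_d9]
  calc P.real {ω | (hits f ω : ℝ) ≤ m / 2}
      ≤ ∫ ω, Real.exp (Real.log 2 * (m / 2)) * ∏ t, g t (f t ω) ∂P := by
        refine measureReal_le_integral ?_ ((integrable_prod_comp_of_finite hf g).const_mul _) ?_ ?_
        · exact measurableSet_le (measurable_from_top.comp (measurable_hits hf)) measurable_const
        · intro ω
          rw [hg]
          positivity
        · intro ω (hω : (hits f ω : ℝ) ≤ m / 2)
          rw [hg, ← Real.exp_add]
          apply Real.one_le_exp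
          nlinarith [Real.log_pos one_lt_two]
    _ = Real.exp (Real.log 2 * (m / 2)) * ∏ t, ∫ ω, g t (f t ω) ∂P := by
        rw [integral_const_mul, integral_prod_comp_of_finite hf hi]
    _ ≤ Real.exp (Real.log 2 * (m / 2)) *
          ∏ t, Real.exp (-(P.real {ω | (f t ω).1 = true} / 2)) := by
        refine mul_le_mul_of_nonneg_left ?_ (Real.exp_nonneg _)
        exact Finset.prod_le_prod (fun t _ => integral_nonneg fun ω => by
          dsimp only [g, Pi.zero_apply]; split_ifs <;> norm_num) fun t _ => hE t
    _ ≤ Real.exp (-(m / 8)) := by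
        rw [← Real.exp_sum, ← Real.exp_add, Finset.sum_neg_distrib, ← Finset.sum_div]
        apply Real.exp_le_exp.2
        nlinarith

/-- Hoeffding's inequality with a random number of trials: conditionally on the set of hits, every
hit is marked independently with probability `q`. -/
theorem marks_upper_tail {f : ι → Ω → Bool × Bool} (hf : ∀ t, Measurable (f t))
    (hi : iIndepFun f P) {q : ℝ} (h0 : 0 ≤ q) (h1 : q ≤ 1)
    (hq : ∀ t, P.real {ω | (f t ω).1 = true ∧ (f t ω).2 = true}
      = q * P.real {ω | (f t ω).1 = true}) {c : ℝ} (hc : 0 ≤ c) :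
    P.real {ω | 0 < hits f ω ∧ c * √(hits f ω) < marks f ω - q * hits f ω}
      ≤ Real.exp (-(2 * c ^ 2)) := by
  classical
  have hS : ∀ t, MeasurableSet {ω | (f t ω).1 = true} := fun t =>
    (measurable_fst.comp (hf t)) (measurableSet_singleton true)
  have hM : ∀ t, MeasurableSet {ω | (f t ω).1 = true ∧ (f t ω).2 = true} := fun t =>
    (hS t).inter ((measurable_snd.comp (hf t)) (measurableSet_singleton true))
  set r : ι → ℝ := fun t => P.real {ω | (f t ω).1 = true} with hr
  -- The optimal Hoeffding parameter for deviation `c √n` in `n = d.card` trials: the exponent is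
  -- `-4c² + l² n / 8 = -2c²`.
  let l : Finset ι → ℝ := fun d => 4 * c / √(d.card : ℝ)
  -- The product over `t` is the exponential weight restricted to the event that the hit set is
  -- exactly `d`. Each term factors over trials although `l` depends on the hit set.
  let g : Finset ι → ι → Bool × Bool → ℝ := fun d t x =>
    if t ∈ d then
      (if x.1 = true then (if x.2 = true then Real.exp (l d * (1 - q)) else Real.exp (-(l d * q)))
        else 0)
    else (if x.1 = true then 0 else 1)
  have hg0 : ∀ d t x, 0 ≤ g d t x := by
    intro d t x
    dsimp only [g]
    split_ifs <;> positivity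
  have hin : ∀ d : Finset ι, ∀ t ∈ d, ∫ ω, g d t (f t ω) ∂P ≤ r t * Real.exp (l d ^ 2 / 8) := by
    intro d t ht
    have e : ∀ ω, g d t (f t ω) = {ω | (f t ω).1 = true}.indicator 1 ω * Real.exp (-(l d * q)) +
        {ω | (f t ω).1 = true ∧ (f t ω).2 = true}.indicator 1 ω *
          (Real.exp (l d * (1 - q)) - Real.exp (-(l d * q))) := by
      intro ω
      by_cases h : (f t ω).1 = true <;> by_cases h' : (f t ω).2 = true <;> simp [g, ht, h, h']
    simp_rw [e]
    rw [integral_add (((integrable_const 1).indicator (hS t)).mul_const _)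
      (((integrable_const 1).indicator (hM t)).mul_const _), integral_mul_const, integral_mul_const,
      integral_indicator_one (hS t), integral_indicator_one (hM t), hq]
    have := mul_le_mul_of_nonneg_left (bernoulli_mgf_le h0 h1 (l d))
      (measureReal_nonneg : 0 ≤ P.real {ω | (f t ω).1 = true})
    simp only [hr]
    linarith
  have hout : ∀ d : Finset ι, ∀ t ∉ d, ∫ ω, g d t (f t ω) ∂P = 1 - r t := by
    intro d t ht
    have e : ∀ ω, g d t (f t ω) = 1 - {ω | (f t ω).1 = true}.indicator 1 ω := by
      intro ω
      by_cases h : (f t ω).1 = true <;> simp [g, ht, h]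
    simp_rw [e]
    rw [integral_sub (integrable_const _) ((integrable_const 1).indicator (hS t)),
      integral_indicator_one (hS t)]
    simp [hr]
  have hE : ∀ d : Finset ι, ∫ ω, ∏ t, g d t (f t ω) ∂P
      ≤ Real.exp (l d ^ 2 / 8 * d.card) * ((∏ t ∈ d, r t) * ∏ t ∈ dᶜ, (1 - r t)) := by
    intro d
    rw [integral_prod_comp_of_finite hf hi, ← Finset.prod_mul_prod_compl d, ← mul_assoc,
      Finset.prod_congr rfl fun t ht => hout d t (Finset.mem_compl.1 ht)]
    refine mul_le_mul_of_nonneg_right ?_ (Finset.prod_nonneg fun t _ => sub_nonneg.2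
      measureReal_le_one)
    calc ∏ t ∈ d, ∫ ω, g d t (f t ω) ∂P ≤ ∏ t ∈ d, r t * Real.exp (l d ^ 2 / 8) :=
          Finset.prod_le_prod (fun t _ => integral_nonneg fun ω => hg0 _ _ _) (hin d)
      _ = _ := by
          rw [Finset.prod_mul_distrib, Finset.prod_const, ← Real.exp_nat_mul]
          ring_nf
  have hval : ∀ ω, ∏ t, g (Finset.univ.filter fun t => (f t ω).1 = true) t (f t ω)
      = Real.exp (l (Finset.univ.filter fun t => (f t ω).1 = true) *
        (marks f ω - q * hits f ω)) := by
    intro ω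
    set d := Finset.univ.filter fun t => (f t ω).1 = true with hd
    have : ∀ t, g d t (f t ω) = Real.exp (l d * ((if (f t ω).1 = true ∧ (f t ω).2 = true then 1
        else 0) - q * (if (f t ω).1 = true then 1 else 0))) := by
      intro t
      by_cases h : (f t ω).1 = true <;> by_cases h' : (f t ω).2 = true <;> simp [g, hd, h, h']
    simp_rw [this]
    rw [← Real.exp_sum, ← Finset.mul_sum, Finset.sum_sub_distrib, ← Finset.mul_sum]
    simp [marks, hits]
  have hmeas : MeasurableSet
      {ω | 0 < hits f ω ∧ c * √(hits f ω) < marks f ω - q * hits f ω} := by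
    have a : Measurable fun ω => (hits f ω : ℝ) := measurable_from_top.comp (measurable_hits hf)
    have b : Measurable fun ω => (marks f ω : ℝ) := measurable_from_top.comp (measurable_marks hf)
    exact (measurableSet_lt measurable_const (measurable_hits hf)).inter
      (measurableSet_lt (a.sqrt.const_mul c) (b.sub (a.const_mul q)))
  calc P.real {ω | 0 < hits f ω ∧ c * √(hits f ω) < marks f ω - q * hits f ω}
      ≤ ∫ ω, ∑ d ∈ Finset.univ.filter (fun d : Finset ι => 0 < d.card),
          Real.exp (-(4 * c ^ 2)) * ∏ t, g d t (f t ω) ∂P := by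
        refine measureReal_le_integral hmeas (integrable_finsetSum _ fun d _ =>
          (integrable_prod_comp_of_finite hf (g d)).const_mul _) ?_ ?_
        · intro ω
          exact Finset.sum_nonneg fun d _ => mul_nonneg (Real.exp_nonneg _)
            (Finset.prod_nonneg fun t _ => hg0 _ _ _)
        · rintro ω ⟨hpos, hlt⟩
          -- The summand of the actual hit set alone is already at least 1.
          refine le_trans ?_ (Finset.single_le_sum (f := fun d : Finset ι =>
            Real.exp (-(4 * c ^ 2)) * ∏ t, g d t (f t ω)) (fun d _ => mul_nonneg (Real.exp_nonneg _)
            (Finset.prod_nonneg fun t _ => hg0 _ _ _))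
            (a := Finset.univ.filter fun t => (f t ω).1 = true) (by simpa [hits] using hpos))
          rw [hval, ← Real.exp_add]
          apply Real.one_le_exp
          have hs : 0 < √(hits f ω : ℝ) := Real.sqrt_pos.2 (by exact_mod_cast hpos)
          have : 4 * c ^ 2 ≤ 4 * c / √(hits f ω : ℝ) * (marks f ω - q * hits f ω) := by
            rw [div_mul_eq_mul_div, le_div_iff₀ hs]
            nlinarith
          simp only [l]
          rw [show (Finset.univ.filter fun t => (f t ω).1 = true).card = hits f ω from rfl]
          linarith
    _ = ∑ d ∈ Finset.univ.filter (fun d : Finset ι => 0 < d.card),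
          Real.exp (-(4 * c ^ 2)) * ∫ ω, ∏ t, g d t (f t ω) ∂P := by
        rw [integral_finsetSum _ fun d _ =>
          (integrable_prod_comp_of_finite hf (g d)).const_mul _]
        simp_rw [integral_const_mul]
    _ ≤ ∑ d ∈ Finset.univ.filter (fun d : Finset ι => 0 < d.card),
          Real.exp (-(2 * c ^ 2)) * ((∏ t ∈ d, r t) * ∏ t ∈ dᶜ, (1 - r t)) := by
        refine Finset.sum_le_sum fun d hd => ?_
        refine (mul_le_mul_of_nonneg_left (hE d) (Real.exp_nonneg _)).trans (le_of_eq ?_)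
        rw [← mul_assoc, ← Real.exp_add]
        have hd' : (0 : ℝ) < d.card := by exact_mod_cast (Finset.mem_filter.1 hd).2
        congr 2
        simp only [l, div_pow, Real.sq_sqrt hd'.le]
        field_simp
        ring
    -- Once the empty set is restored, the weights are the law of the hit set and sum to `∏ (r t +
    -- (1 - r t)) = 1`.
    _ ≤ ∑ d : Finset ι, Real.exp (-(2 * c ^ 2)) * ((∏ t ∈ d, r t) * ∏ t ∈ dᶜ, (1 - r t)) :=
        Finset.sum_le_sum_of_subset_of_nonneg (Finset.filter_subset _ _) fun d _ _ =>
          mul_nonneg (Real.exp_nonneg _) (mul_nonneg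
            (Finset.prod_nonneg fun t _ => measureReal_nonneg)
            (Finset.prod_nonneg fun t _ => sub_nonneg.2 measureReal_le_one))
    _ = Real.exp (-(2 * c ^ 2)) := by
        rw [← Finset.mul_sum, ← Fintype.prod_add]
        simp

/-- The lower-tail counterpart of `marks_upper_tail`. -/
theorem marks_lower_tail {f : ι → Ω → Bool × Bool} (hf : ∀ t, Measurable (f t))
    (hi : iIndepFun f P) {q : ℝ} (h0 : 0 ≤ q) (h1 : q ≤ 1)
    (hq : ∀ t, P.real {ω | (f t ω).1 = true ∧ (f t ω).2 = true}
      = q * P.real {ω | (f t ω).1 = true}) {c : ℝ} (hc : 0 ≤ c) :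
    P.real {ω | 0 < hits f ω ∧ c * √(hits f ω) < q * hits f ω - marks f ω}
      ≤ Real.exp (-(2 * c ^ 2)) := by
  let flip : Bool × Bool → Bool × Bool := fun x => (x.1, !x.2)
  have hflip : Measurable flip := measurable_of_finite _
  have hS : ∀ t, MeasurableSet {ω | (f t ω).1 = true} := fun t =>
    (measurable_fst.comp (hf t)) (measurableSet_singleton true)
  have hM : ∀ t, MeasurableSet {ω | (f t ω).1 = true ∧ (f t ω).2 = true} := fun t =>
    (hS t).inter ((measurable_snd.comp (hf t)) (measurableSet_singleton true))
  have hh : ∀ ω, hits (fun t ω => flip (f t ω)) ω = hits f ω := fun ω => rfl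
  have hm : ∀ ω, (marks (fun t ω => flip (f t ω)) ω : ℝ) = hits f ω - marks f ω := by
    intro ω
    rw [eq_sub_iff_add_eq]
    have := Finset.card_filter_add_card_filter_not (s := Finset.univ.filter
      fun t => (f t ω).1 = true) (fun t => (f t ω).2 = false)
    simp only [Finset.filter_filter, Bool.not_eq_false] at this
    simp only [marks, hits, flip, Bool.not_eq_true']
    exact_mod_cast this
  have key := marks_upper_tail (P := P) (f := fun t ω => flip (f t ω))
    (fun t => hflip.comp (hf t)) (hi.comp _ fun _ => hflip) (q := 1 - q) (by linarith)
    (by linarith) ?_ hc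
  · simp only [hh, hm] at key
    refine le_trans (le_of_eq ?_) key
    congr 1
    ext ω
    simp only [Set.mem_ofPred_eq]
    constructor <;> rintro ⟨a, b⟩ <;> exact ⟨a, by linarith⟩
  · intro t
    have e : {ω | (flip (f t ω)).1 = true ∧ (flip (f t ω)).2 = true}
        = {ω | (f t ω).1 = true} \ {ω | (f t ω).1 = true ∧ (f t ω).2 = true} := by
      ext ω
      simp [flip]
      tauto
    have hsub : {ω | (f t ω).1 = true ∧ (f t ω).2 = true} ⊆ {ω | (f t ω).1 = true} :=
      fun ω h => h.1
    rw [e, measureReal_sdiff hsub (hM t), hq]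
    simp only [flip]
    ring

end Counting

/-! ### Independence of blocks, and freezing a random parameter. -/

/-- Disjoint blocks of an independent family are independent. -/
theorem iIndepFun_curry {Ω ι κ α : Type*} [MeasurableSpace Ω] [MeasurableSpace α]
    {P : Measure Ω} {Z : ι × κ → Ω → α} (hZ : ∀ q, Measurable (Z q)) (h : iIndepFun Z P) :
    iIndepFun (fun t ω k => Z (t, k) ω) P := by
  have := h.isProbabilityMeasure
  have hP : ∀ i j, IsProbabilityMeasure (P.map (Z (i, j))) := fun i j =>
    Measure.isProbabilityMeasure_map (hZ _).aemeasurable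
  rw [iIndepFun_iff_map_fun_eq_infinitePi_map fun t => measurable_pi_iff.2 fun k => hZ (t, k)]
  have hblock : ∀ t, P.map (fun ω k => Z (t, k) ω) =
      Measure.infinitePi fun k => P.map (Z (t, k)) := fun t =>
    (h.precomp (g := fun k => (t, k)) fun _ _ e => (Prod.mk.inj e).2).map_fun_eq_infinitePi_map
      fun k => hZ _
  simp_rw [hblock]
  rw [← Measure.infinitePi_map_curry fun t k => P.map (Z (t, k)),
    ← h.map_fun_eq_infinitePi_map hZ, Measure.map_map (by fun_prop) (measurable_pi_iff.2 hZ)]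
  rfl

/-- Freezing an independent parameter: if an event has probability at most `c` for every value of
the parameter, then so it has for a random independent one. -/
theorem measureReal_of_indepFun_le {Ω α β : Type*} [MeasurableSpace Ω] [MeasurableSpace α]
    [MeasurableSpace β] [Fintype α] [MeasurableSingletonClass α] {P : Measure Ω}
    [IsProbabilityMeasure P] {U : Ω → α} {V : Ω → β} (hU : Measurable U) (hUV : IndepFun U V P)
    {G : α → Set β} (hG : ∀ a, MeasurableSet (G a)) {c : ℝ} (hc : ∀ a, P.real (V ⁻¹' G a) ≤ c) :
    P.real {ω | V ω ∈ G (U ω)} ≤ c := by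
  have e : {ω | V ω ∈ G (U ω)} = ⋃ a, U ⁻¹' {a} ∩ V ⁻¹' G a := by
    ext ω
    simp
  rw [e]
  calc P.real (⋃ a, U ⁻¹' {a} ∩ V ⁻¹' G a) ≤ ∑ a, P.real (U ⁻¹' {a} ∩ V ⁻¹' G a) :=
        measureReal_iUnion_fintype_le _
    _ = ∑ a, P.real (U ⁻¹' {a}) * P.real (V ⁻¹' G a) := by
        refine Finset.sum_congr rfl fun a _ => ?_
        simp only [measureReal_def]
        rw [hUV.measure_inter_preimage_eq_mul _ _ (measurableSet_singleton a) (hG a),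
          ENNReal.toReal_mul]
    _ ≤ ∑ a, P.real (U ⁻¹' {a}) * c := by
        gcongr with a
        exact hc a
    _ = c := by
        rw [← Finset.sum_mul, sum_measureReal_preimage_singleton _ fun a _ =>
          hU (measurableSet_singleton a)]
        simp

theorem exploreOrder_apply {k : ℕ} (σ : ArmOrder (k + 1)) (t : ℕ) (j : Fin (k + 1)) :
    exploreOrder σ t j = σ (Fin.ofNat (k + 1) (j + t)) := by
  induction t generalizing j with
  | zero => simp [exploreOrder]
  | succ t ih =>
    rw [exploreOrder, Equiv.trans_apply, ih]
    congr 1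
    apply Fin.ext
    simp only [finRotate_apply, Fin.val_add, Fin.val_ofNat, Fin.val_one', Nat.mod_add_mod,
      Nat.add_mod_mod]
    ring_nf

/-! ### Exploration slots as independent trials. -/

open Classical in
/-- What slot `t` of the exploration tells about arm `i`: whether the arm is displayed, and whether
its feedback is zero. -/
def armSample {K : ℕ} {Ω : Type*} (X Y : ℕ → Fin K → Ω → Bool) (σ : ArmOrder K) (i : Fin K)
    (t : ℕ) (ω : Ω) : Bool × Bool :=
  (decide (Displays (exploreOrder σ t) (fun k => X t k ω) i), !Y t i ω)

section Samples

variable {K : ℕ} {Ω : Type*} (X Y : ℕ → Fin K → Ω → Bool) (σ : ArmOrder K)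

theorem armSample_fst_eq_true_iff (i : Fin K) (t : ℕ) (ω : Ω) :
    (armSample X Y σ i t ω).1 = true ↔
      X t i ω = true ∧ ∀ j, j < (exploreOrder σ t).symm i → X t (exploreOrder σ t j) ω = false := by
  classical
  exact decide_eq_true_iff

theorem armSample_snd_eq_true_iff (i : Fin K) (t : ℕ) (ω : Ω) :
    (armSample X Y σ i t ω).2 = true ↔ Y t i ω = false := by
  simp [armSample]

theorem hits_armSample (n : ℕ) (i : Fin K) (ω : Ω) :
    hits (fun t : Fin n => armSample X Y σ i t) ω = displayCount X σ n i ω := by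
  classical
  simp only [hits, displayCount, armSample, Finset.card_filter, Finset.sum_range,
    decide_eq_true_eq]

theorem marks_armSample (n : ℕ) (i : Fin K) (ω : Ω) :
    marks (fun t : Fin n => armSample X Y σ i t) ω = errorCount X Y σ n i ω := by
  classical
  simp only [marks, errorCount, armSample, Finset.card_filter, Finset.sum_range,
    decide_eq_true_eq, Bool.not_eq_true']

variable {X Y} [MeasurableSpace Ω]

theorem measurable_armSample (hX : ∀ t i, Measurable (X t i)) (hY : ∀ t i, Measurable (Y t i))
    (i : Fin K) (t : ℕ) : Measurable (armSample X Y σ i t) := by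
  classical
  exact (measurable_of_finite fun x : Fin K → Bool × Bool =>
    (decide (Displays (exploreOrder σ t) (fun k => (x k).1) i), !(x i).2)).comp
    (measurable_pi_iff.2 fun k => (hX t k).prodMk (hY t k))

theorem measurable_displayCount (hX : ∀ t i, Measurable (X t i)) (n : ℕ) (i : Fin K) :
    Measurable (displayCount X σ n i) := by
  have h := measurable_hits fun t : Fin n => measurable_armSample σ hX hX i t
  rwa [funext fun ω => hits_armSample X X σ n i ω] at h

theorem measurable_errorCount (hX : ∀ t i, Measurable (X t i)) (hY : ∀ t i, Measurable (Y t i))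
    (n : ℕ) (i : Fin K) : Measurable (errorCount X Y σ n i) := by
  have h := measurable_marks fun t : Fin n => measurable_armSample σ hX hY i t
  rwa [funext fun ω => marks_armSample X Y σ n i ω] at h

end Samples

/-! ### Display and error probabilities in the cascade. -/

namespace IsEnvironment

variable {K : ℕ} {Ω : Type*} [MeasurableSpace Ω] {P : Measure Ω}
  {μ p : Fin K → ℝ} {X Y : ℕ → Fin K → Ω → Bool}

theorem measurable_pair (h : IsEnvironment P μ p X Y) (q : ℕ × Fin K) :
    Measurable fun ω => (X q.1 q.2 ω, Y q.1 q.2 ω) :=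
  (h.measurable_output _ _).prodMk (h.measurable_feedback _ _)

theorem iIndepFun_armSample (h : IsEnvironment P μ p X Y) (σ : ArmOrder K) (i : Fin K) :
    iIndepFun (armSample X Y σ i) P := by
  classical
  exact (iIndepFun_curry h.measurable_pair h.indep).comp
    (fun t (x : Fin K → Bool × Bool) =>
      (decide (Displays (exploreOrder σ t) (fun k => (x k).1) i), !(x i).2))
    fun t => measurable_of_finite _

theorem prob_output_error [IsFiniteMeasure P] (h : IsEnvironment P μ p X Y) (t : ℕ) (i : Fin K) :
    P {ω | X t i ω = true ∧ Y t i ω = false}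
      = ENNReal.ofReal (p i) * P {ω | X t i ω = true} := by
  have hA : MeasurableSet {ω | X t i ω = true} :=
    h.measurable_output t i (measurableSet_singleton true)
  rw [← h.prob_error t i, cond_mul_eq_inter hA]
  rfl

/-- The output and feedback of arm `i` are independent of the outputs of the arms placed before it.
-/
theorem measure_inter_blocked (h : IsEnvironment P μ p X Y) (τ : ArmOrder K) (t : ℕ) (i : Fin K)
    (A : Set (Bool × Bool)) :
    P {ω | (X t i ω, Y t i ω) ∈ A ∧ ∀ j, j < τ.symm i → X t (τ j) ω = false}
      = P {ω | (X t i ω, Y t i ω) ∈ A} *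
        ∏ k ∈ Finset.univ.erase i, P {ω | τ.symm k < τ.symm i → X t k ω = false} := by
  let W : Fin K → Ω → Bool × Bool := fun k ω => (X t k ω, Y t k ω)
  have hW : iIndepFun W P :=
    h.indep.precomp (g := fun k => (t, k)) fun _ _ e => (Prod.mk.inj e).2
  -- Arms placed after `i` get the whole space, so a single product over all arms expresses the
  -- event.
  let s : Fin K → Set (Bool × Bool) := fun k =>
    if k = i then A else {x | τ.symm k < τ.symm i → x.1 = false}
  have key := hW.measure_inter_preimage_eq_mul Finset.univ (sets := s)
    fun k _ => (Set.toFinite (s k)).measurableSet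
  rw [← Finset.mul_prod_erase _ _ (Finset.mem_univ i)] at key
  convert key using 2
  · ext ω
    simp only [Set.mem_ofPred_eq, Set.mem_iInter, Set.mem_preimage, Finset.mem_univ, true_imp_iff]
    constructor
    · rintro ⟨hA, hb⟩ k
      by_cases hk : k = i
      · subst hk
        simpa [s, W] using hA
      · simp only [s, hk, if_false, W]
        intro hlt
        simpa using hb (τ.symm k) hlt
    · intro hs
      refine ⟨by simpa [s, W] using hs i, fun j hj => ?_⟩
      have := hs (τ j)
      have hne : τ j ≠ i := by
        rintro rfl
        simp at hj
      simp only [s, hne, if_false, W] at this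
      exact this (by simpa using hj)
  · simp [s, W]
    rfl
  · refine Finset.prod_congr rfl fun k hk => ?_
    simp only [s, Finset.ne_of_mem_erase hk, if_false]
    rfl

/-- The blocking factor of the preceding arms is common to both probabilities, leaving only the
conditional error probability of arm `i`. This is the marking hypothesis of the tail bounds. -/
theorem prob_armSample [IsFiniteMeasure P] (h : IsEnvironment P μ p X Y) (hp : ∀ i, 0 ≤ p i) (σ : ArmOrder K)
    (i : Fin K) (t : ℕ) :
    P.real {ω | (armSample X Y σ i t ω).1 = true ∧ (armSample X Y σ i t ω).2 = true}
      = p i * P.real {ω | (armSample X Y σ i t ω).1 = true} := by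
  have h1 := h.measure_inter_blocked (exploreOrder σ t) t i {(true, false)}
  have h2 := h.measure_inter_blocked (exploreOrder σ t) t i {x | x.1 = true}
  have h3 := h.prob_output_error t i
  have e1 : {ω | (armSample X Y σ i t ω).1 = true ∧ (armSample X Y σ i t ω).2 = true}
      = {ω | (X t i ω, Y t i ω) ∈ ({(true, false)} : Set (Bool × Bool)) ∧
        ∀ j, j < (exploreOrder σ t).symm i → X t (exploreOrder σ t j) ω = false} := by
    ext ω
    simp only [armSample_fst_eq_true_iff, armSample_snd_eq_true_iff, Set.mem_ofPred_eq,
      Set.mem_singleton_iff, Prod.mk.injEq]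
    tauto
  have e2 : {ω | (armSample X Y σ i t ω).1 = true}
      = {ω | (X t i ω, Y t i ω) ∈ {x : Bool × Bool | x.1 = true} ∧
        ∀ j, j < (exploreOrder σ t).symm i → X t (exploreOrder σ t j) ω = false} := by
    ext ω
    exact armSample_fst_eq_true_iff X Y σ i t ω
  have e3 : {ω | (X t i ω, Y t i ω) ∈ ({(true, false)} : Set (Bool × Bool))}
      = {ω | X t i ω = true ∧ Y t i ω = false} := by
    ext ω
    simp
  have e4 : {ω | (X t i ω, Y t i ω) ∈ {x : Bool × Bool | x.1 = true}} = {ω | X t i ω = true} := rfl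
  rw [e3, h3] at h1
  rw [e4] at h2
  rw [measureReal_def, measureReal_def, e1, e2, h1, h2, mul_assoc, ENNReal.toReal_mul,
    ENNReal.toReal_ofReal (hp i)]

/-- During `N` exploration rounds every arm is `N` times the first one in the ordering. -/
theorem le_sum_prob_display [IsFiniteMeasure P] (h : IsEnvironment P μ p X Y) (hμ : ∀ i, 0 ≤ μ i) (σ : ArmOrder K)
    (i : Fin K) (N : ℕ) :
    N * μ i ≤ ∑ t : Fin (N * K), P.real {ω | (armSample X Y σ i t ω).1 = true} := by
  obtain _ | k := K
  · exact i.elim0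
  set m : Fin (k + 1) := σ.symm i with hm
  -- An arm initially at position `m` is in front in the slots congruent to `m` modulo the number of
  -- arms, and is then displayed exactly when it outputs one.
  have hfirst : ∀ a : ℕ,
      P.real {ω | (armSample X Y σ i (a * (k + 1) + m) ω).1 = true} = μ i := by
    intro a
    have h0 : (exploreOrder σ (a * (k + 1) + m)).symm i = 0 := by
      rw [Equiv.symm_apply_eq, exploreOrder_apply]
      have : Fin.ofNat (k + 1) ((0 : Fin (k + 1)) + (a * (k + 1) + m)) = m := by
        apply Fin.ext
        simp [Nat.mod_eq_of_lt m.isLt]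
      rw [this, hm, Equiv.apply_symm_apply]
    have e : {ω | (armSample X Y σ i (a * (k + 1) + m) ω).1 = true}
        = {ω | X (a * (k + 1) + m) i ω = true} := by
      ext ω
      simp [armSample_fst_eq_true_iff, h0]
    rw [e, measureReal_def, h.prob_output, ENNReal.toReal_ofReal (hμ i)]
  rw [← Finset.sum_range fun t => P.real {ω | (armSample X Y σ i t ω).1 = true}]
  calc (N : ℝ) * μ i = ∑ a ∈ Finset.range N,
        P.real {ω | (armSample X Y σ i (a * (k + 1) + m) ω).1 = true} := by
        rw [Finset.sum_congr rfl fun a _ => hfirst a]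
        simp
    _ = ∑ t ∈ (Finset.range N).image fun a => a * (k + 1) + (m : ℕ),
        P.real {ω | (armSample X Y σ i t ω).1 = true} := by
        rw [Finset.sum_image]
        intro a _ b _ hab
        simpa using hab
    _ ≤ _ := by
        refine Finset.sum_le_sum_of_subset_of_nonneg ?_ fun _ _ _ => measureReal_nonneg
        intro t ht
        obtain ⟨a, ha, rfl⟩ := Finset.mem_image.1 ht
        have ha := Finset.mem_range.1 ha
        rw [Finset.mem_range]
        calc a * (k + 1) + m < a * (k + 1) + (k + 1) := by
              have := m.isLt
              omega
          _ = (a + 1) * (k + 1) := by ring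
          _ ≤ N * (k + 1) := Nat.mul_le_mul_right _ ha

end IsEnvironment

/-! ### Reliable statistics force the correct order. -/

/-- The statistics of arm `i` after `N` exploration rounds are misleading: the arm has been displayed
too rarely (this matters for all arms but the first), or its empirical error probability is outside
of its confidence interval. -/
def IsMisleading {K : ℕ} {Ω : Type*} (X Y : ℕ → Fin K → Ω → Bool) (μ p : Fin K → ℝ) (T N : ℕ)
    (σ : ArmOrder K) (i : Fin K) (ω : Ω) : Prop :=
  (0 < (i : ℕ) ∧ (displayCount X σ (N * K) i ω : ℝ) ≤ N * μ i / 2) ∨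
  (0 < displayCount X σ (N * K) i ω ∧ √(2 * Real.log T) * √(displayCount X σ (N * K) i ω)
    < errorCount X Y σ (N * K) i ω - p i * displayCount X σ (N * K) i ω) ∨
  (0 < displayCount X σ (N * K) i ω ∧ √(2 * Real.log T) * √(displayCount X σ (N * K) i ω)
    < p i * displayCount X σ (N * K) i ω - errorCount X Y σ (N * K) i ω)

section Gap

variable {K : ℕ} {μ p : Fin K → ℝ}

theorem gap_pos (hmono : StrictMono p) {i : Fin K} (hi : 0 < (i : ℕ)) : 0 < gap p i :=
  sub_pos.2 (hmono (Fin.lt_def.2 (Nat.sub_lt hi one_pos)))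

theorem gap_le_one (hp : ∀ i, 0 ≤ p i ∧ p i ≤ 1) (i : Fin K) : gap p i ≤ 1 := by
  have h1 := (hp i).2
  have h2 := (hp ⟨(i : ℕ) - 1, lt_of_le_of_lt (Nat.sub_le _ _) i.isLt⟩).1
  unfold gap
  linarith

theorem le_exploreRounds_mul (hμ : ∀ i, 0 < μ i) (hmono : StrictMono p) (T : ℕ) {i : Fin K}
    (hi : 0 < (i : ℕ)) : 16 * Real.log T / gap p i ^ 2 ≤ exploreRounds μ p T * μ i := by
  have h1 : ⌈16 * Real.log T / (gap p i ^ 2 * μ i)⌉₊ ≤ exploreRounds μ p T :=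
    Finset.le_sup (f := fun i : Fin K => ⌈16 * Real.log T / (gap p i ^ 2 * μ i)⌉₊)
      (Finset.mem_filter.2 ⟨Finset.mem_univ i, hi⟩)
  have h2 := (Nat.le_ceil (16 * Real.log T / (gap p i ^ 2 * μ i))).trans (Nat.cast_le.2 h1)
  have := gap_pos hmono hi
  rwa [← div_div, div_le_iff₀ (hμ i)] at h2

/-- The maximum is bounded by the sum. The first arm is harmless there: its `gap` is 0, and division
by zero gives 0. -/
theorem exploreRounds_le (hμ : ∀ i, 0 < μ i) (T : ℕ) :
    (exploreRounds μ p T : ℝ) ≤ (∑ i, 16 / (gap p i ^ 2 * μ i)) * Real.log T + 1 := by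
  have hL : 0 ≤ Real.log T := Real.log_natCast_nonneg T
  have hterm : ∀ i : Fin K, 0 ≤ 16 / (gap p i ^ 2 * μ i) := fun i =>
    div_nonneg (by norm_num) (mul_nonneg (sq_nonneg _) (hμ i).le)
  have hsum : 0 ≤ (∑ i, 16 / (gap p i ^ 2 * μ i)) * Real.log T :=
    mul_nonneg (Finset.sum_nonneg fun i _ => hterm i) hL
  have : exploreRounds μ p T ≤ ⌈(∑ i, 16 / (gap p i ^ 2 * μ i)) * Real.log T⌉₊ := by
    refine Finset.sup_le fun i _ => Nat.ceil_mono ?_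
    rw [mul_div_right_comm]
    exact mul_le_mul_of_nonneg_right
      (Finset.single_le_sum (fun i _ => hterm i) (Finset.mem_univ i)) hL
  exact (Nat.cast_le.2 this).trans (Nat.ceil_lt_add_one hsum).le

end Gap

section Lcb

variable {K : ℕ} {Ω : Type*} {X Y : ℕ → Fin K → Ω → Bool} {μ p : Fin K → ℝ} {T N : ℕ}
  {σ : ArmOrder K} {i : Fin K} {ω : Ω}

theorem lcb_le_of_not_isMisleading (h : ¬ IsMisleading X Y μ p T N σ i ω) :
    lcb X Y T σ (N * K) i ω ≤ (p i : EReal) := by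
  unfold lcb
  split_ifs with h0
  · exact bot_le
  · have hS : 0 < displayCount X σ (N * K) i ω := Nat.pos_of_ne_zero h0
    simp only [IsMisleading, not_or, not_and, not_lt] at h
    have h2 := h.2.1 hS
    have hS' : (0 : ℝ) < displayCount X σ (N * K) i ω := by exact_mod_cast hS
    rw [EReal.coe_le_coe_iff, Real.sqrt_div' _ hS'.le, tsub_le_iff_right, div_le_iff₀ hS', add_mul,
      div_mul_eq_mul_div, mul_div_assoc, Real.div_sqrt]
    linarith

/-- The LCB is at least `p i` minus twice the radius, and enough displays make the radius less than
half the gap. -/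
theorem lt_lcb_of_not_isMisleading (hgap : 0 < gap p i) (hi : 0 < (i : ℕ))
    (hN : 16 * Real.log T / gap p i ^ 2 ≤ N * μ i) (h : ¬ IsMisleading X Y μ p T N σ i ω) :
    ((p i - gap p i : ℝ) : EReal) < lcb X Y T σ (N * K) i ω := by
  simp only [IsMisleading, not_or, not_and, not_lt, not_le] at h
  have h1 := h.1 hi
  have hL : 0 ≤ Real.log T := Real.log_natCast_nonneg T
  have hS' : (0 : ℝ) < displayCount X σ (N * K) i ω := by
    have : 0 ≤ 16 * Real.log T / gap p i ^ 2 := by positivity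
    linarith
  have hS : 0 < displayCount X σ (N * K) i ω := by exact_mod_cast hS'
  have h3 := h.2.2 hS
  rw [lcb, if_neg hS.ne', EReal.coe_lt_coe_iff]
  set S : ℝ := ((displayCount X σ (N * K) i ω : ℕ) : ℝ)
  have hr : √(2 * Real.log T / S) < gap p i / 2 := by
    rw [Real.sqrt_lt' (by positivity), div_lt_iff₀ hS']
    rw [div_le_iff₀ (by positivity)] at hN
    nlinarith [sq_pos_of_pos hgap]
  have hE : p i - √(2 * Real.log T / S) ≤ errorCount X Y σ (N * K) i ω / S := by
    rw [le_div_iff₀ hS', Real.sqrt_div' _ hS'.le, sub_mul, div_mul_eq_mul_div, mul_div_assoc,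
      Real.div_sqrt]
    linarith
  linarith

theorem strictMono_lcb (hμ : ∀ i, 0 < μ i) (hmono : StrictMono p)
    (h : ∀ i, ¬ IsMisleading X Y μ p T (exploreRounds μ p T) σ i ω) :
    StrictMono fun i => lcb X Y T σ (exploreRounds μ p T * K) i ω := by
  intro i j hij
  have hj : 0 < (j : ℕ) := lt_of_le_of_lt (Nat.zero_le _) (Fin.lt_def.1 hij)
  refine (lcb_le_of_not_isMisleading (h i)).trans_lt (lt_of_le_of_lt ?_
    (lt_lcb_of_not_isMisleading (gap_pos hmono hj) hj (le_exploreRounds_mul hμ hmono T hj) (h j)))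
  rw [EReal.coe_le_coe_iff, gap, sub_sub_cancel]
  refine hmono.monotone (Fin.le_def.2 ?_)
  have := Fin.lt_def.1 hij
  simp only
  omega

end Lcb

theorem measurableSet_isMisleading {K : ℕ} {Ω : Type*} [MeasurableSpace Ω]
    {X Y : ℕ → Fin K → Ω → Bool} (hX : ∀ t i, Measurable (X t i)) (hY : ∀ t i, Measurable (Y t i))
    (μ p : Fin K → ℝ) (T N : ℕ) (σ : ArmOrder K) (i : Fin K) :
    MeasurableSet {ω | IsMisleading X Y μ p T N σ i ω} := by
  have hS : Measurable fun ω => (displayCount X σ (N * K) i ω : ℝ) :=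
    measurable_from_top.comp (measurable_displayCount σ hX _ i)
  have hE : Measurable fun ω => (errorCount X Y σ (N * K) i ω : ℝ) :=
    measurable_from_top.comp (measurable_errorCount σ hX hY _ i)
  have h0 : MeasurableSet {ω | 0 < displayCount X σ (N * K) i ω} :=
    measurableSet_lt measurable_const (measurable_displayCount σ hX _ i)
  refine ((MeasurableSet.const _).inter (measurableSet_le hS measurable_const)).union
    ((h0.inter ?_).union (h0.inter ?_))
  · exact measurableSet_lt (hS.sqrt.const_mul _) (hE.sub (hS.const_mul _))
  · exact measurableSet_lt (hS.sqrt.const_mul _) ((hS.const_mul _).sub hE)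

/-! ### Failure probability and regret. -/

section Probability

variable {K : ℕ} {Ω : Type*} [MeasurableSpace Ω] {P : Measure Ω} [IsProbabilityMeasure P]
  {μ p : Fin K → ℝ} {X Y : ℕ → Fin K → Ω → Bool}

theorem exp_neg_mul_log {T : ℕ} (hT : 1 ≤ T) (n : ℕ) :
    Real.exp (-(n * Real.log T)) = 1 / (T : ℝ) ^ n := by
  have : (0 : ℝ) < T := by exact_mod_cast hT
  rw [Real.exp_neg, Real.exp_nat_mul, Real.exp_log this, one_div]

theorem IsEnvironment.prob_isMisleading_le (h : IsEnvironment P μ p X Y) (hμ : ∀ i, 0 < μ i)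
    (hp : ∀ i, 0 ≤ p i ∧ p i ≤ 1) (hmono : StrictMono p) {T : ℕ} (hT : 1 ≤ T) (σ : ArmOrder K)
    (i : Fin K) :
    P.real {ω | IsMisleading X Y μ p T (exploreRounds μ p T) σ i ω}
      ≤ 1 / (T : ℝ) ^ 2 + 2 / (T : ℝ) ^ 4 := by
  set N := exploreRounds μ p T with hN
  have hL : 0 ≤ Real.log T := Real.log_natCast_nonneg T
  have hmeas : ∀ t : Fin (N * K), Measurable (armSample X Y σ i t) := fun t =>
    measurable_armSample σ h.measurable_output h.measurable_feedback i t
  have hind : iIndepFun (fun t : Fin (N * K) => armSample X Y σ i t) P :=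
    (h.iIndepFun_armSample σ i).precomp Fin.val_injective
  have hprob : ∀ t : Fin (N * K), _ := fun t => h.prob_armSample (fun i => (hp i).1) σ i t
  have hexp : Real.exp (-(2 * √(2 * Real.log T) ^ 2)) = 1 / (T : ℝ) ^ 4 := by
    rw [Real.sq_sqrt (by positivity), ← exp_neg_mul_log hT]
    congr 1
    push_cast
    ring
  have h1 : P.real {ω | 0 < (i : ℕ) ∧ (displayCount X σ (N * K) i ω : ℝ) ≤ N * μ i / 2}
      ≤ 1 / (T : ℝ) ^ 2 := by
    by_cases hi : 0 < (i : ℕ)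
    · have := hits_lower_tail hmeas hind (mul_nonneg (Nat.cast_nonneg N) (hμ i).le)
        (h.le_sum_prob_display (fun i => (hμ i).le) σ i N)
      simp only [hits_armSample] at this
      simp only [hi, true_and]
      refine this.trans ?_
      rw [← exp_neg_mul_log hT]
      apply Real.exp_le_exp.2
      have hb := le_exploreRounds_mul hμ hmono T hi
      have hg := gap_pos hmono hi
      have hg1 := gap_le_one hp i
      have : 16 * Real.log T ≤ 16 * Real.log T / gap p i ^ 2 :=
        -- Since the gap is at most 1, the expected number of displays is at least `16 log T`, and
        -- the Chernoff bound gives `exp (-2 log T)`.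
        le_div_self (by positivity) (by positivity) (by nlinarith)
      push_cast
      linarith
    · simp only [hi, false_and]
      simp
  have h2 := marks_upper_tail hmeas hind (hp i).1 (hp i).2 hprob
    (Real.sqrt_nonneg (2 * Real.log T))
  have h3 := marks_lower_tail hmeas hind (hp i).1 (hp i).2 hprob
    (Real.sqrt_nonneg (2 * Real.log T))
  simp only [hits_armSample, marks_armSample, hexp] at h2 h3
  have := (measureReal_union_le _ _).trans (add_le_add h1 ((measureReal_union_le _ _).trans
    (add_le_add h2 h3)))
  refine le_trans this (le_of_eq ?_)
  ring

theorem prob_commit_ne_optOrder_le (hμ : ∀ i, 0 < μ i) (hp : ∀ i, 0 ≤ p i ∧ p i ≤ 1)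
    (hmono : StrictMono p) {T : ℕ} (hT : 1 ≤ T) {init commit : Ω → ArmOrder K}
    (h : IsEnvironment P μ p X Y) (hrun : IsECRun P μ p X Y T init commit) :
    P.real {ω | commit ω ≠ optOrder K} ≤ (K : ℝ) / (T : ℝ) ^ 2 + (K : ℝ) ^ 2 / (T : ℝ) ^ 4 := by
  -- The union bound yields `2K / T⁴`, which is at most `K² / T⁴` only for `K ≥ 2`; with fewer arms
  -- there is just one ordering.
  rcases Nat.lt_or_ge K 2 with hK | hK
  · have : Subsingleton (Fin K) := by
      rw [Fin.subsingleton_iff_le_one]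
      omega
    have e : {ω | commit ω ≠ optOrder K} = ∅ := by
      ext ω
      simp [Subsingleton.elim (commit ω) (optOrder K)]
    rw [e, measureReal_empty]
    positivity
  -- Misleading events are rewritten as sets of environment paths, so that independence of the
  -- initial ordering from the path applies.
  let E : Type := ℕ × Fin K → Bool × Bool
  let X' : ℕ → Fin K → E → Bool := fun t i e => (e (t, i)).1
  let Y' : ℕ → Fin K → E → Bool := fun t i e => (e (t, i)).2
  have hX' : ∀ t i, Measurable (X' t i) := fun t i => measurable_fst.comp (measurable_pi_apply _)
  have hY' : ∀ t i, Measurable (Y' t i) := fun t i => measurable_snd.comp (measurable_pi_apply _)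
  let G : ArmOrder K → Set E := fun σ =>
    {e | ∃ i, IsMisleading X' Y' μ p T (exploreRounds μ p T) σ i e}
  have hG : ∀ σ, MeasurableSet (G σ) := fun σ => by
    simp only [G, Set.ofPred_exists]
    exact MeasurableSet.iUnion fun i => measurableSet_isMisleading hX' hY' μ p T _ σ i
  let V : Ω → E := fun ω q => (X q.1 q.2 ω, Y q.1 q.2 ω)
  have hGV : ∀ σ ω, V ω ∈ G σ ↔ ∃ i, IsMisleading X Y μ p T (exploreRounds μ p T) σ i ω :=
    fun σ ω => Iff.rfl
  have hsub : {ω | commit ω ≠ optOrder K} ⊆ {ω | V ω ∈ G (init ω)} := by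
    intro ω hω
    by_contra hgood
    have hgood : ∀ i, ¬ IsMisleading X Y μ p T (exploreRounds μ p T) (init ω) i ω := by
      simpa [hGV] using hgood
    -- A monotone permutation of `Fin K` is the identity; strictness of the LCBs removes any effect
    -- of tie-breaking.
    refine hω ((Equiv.Perm.monotone_iff _).1 fun a b hab => ?_)
    exact (strictMono_lcb hμ hmono hgood).le_iff_le.1 (hrun.ascending ω hab)
  refine (measureReal_mono hsub).trans (measureReal_of_indepFun_le hrun.measurable_init
    hrun.indep_init hG fun σ => ?_)
  have e : V ⁻¹' G σ = ⋃ i, {ω | IsMisleading X Y μ p T (exploreRounds μ p T) σ i ω} := by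
    ext ω
    simp [hGV]
  have hK' : (2 : ℝ) ≤ K := by exact_mod_cast hK
  have hT' : (0 : ℝ) < T := by exact_mod_cast hT
  calc P.real (V ⁻¹' G σ)
      ≤ ∑ i, P.real {ω | IsMisleading X Y μ p T (exploreRounds μ p T) σ i ω} := by
        rw [e]
        exact measureReal_iUnion_fintype_le _
    _ ≤ ∑ _i : Fin K, (1 / (T : ℝ) ^ 2 + 2 / (T : ℝ) ^ 4) :=
        Finset.sum_le_sum fun i _ => h.prob_isMisleading_le hμ hp hmono hT σ i
    _ = (K : ℝ) / (T : ℝ) ^ 2 + 2 * K / (T : ℝ) ^ 4 := by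
        rw [Finset.sum_const, Finset.card_univ, Fintype.card_fin, nsmul_eq_mul]
        ring
    _ ≤ _ := by
        gcongr
        nlinarith

/-- The expected regret in one slot, in terms of the probability of a suboptimal ordering. -/
theorem abs_integral_regret_le {L : Ω → ArmOrder K} (hL : Measurable L) :
    |∫ ω, (expectedReward μ p (optOrder K) - expectedReward μ p (L ω)) ∂P|
      ≤ (∑ σ, |expectedReward μ p (optOrder K) - expectedReward μ p σ|)
        * P.real {ω | L ω ≠ optOrder K} := by
  have hA : MeasurableSet {ω | L ω ≠ optOrder K} := hL (t := {optOrder K}ᶜ) trivial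
  rw [← integral_indicator_one hA, ← integral_const_mul, ← Real.norm_eq_abs]
  refine norm_integral_le_of_norm_le (((integrable_const 1).indicator hA).const_mul _)
    (Filter.Eventually.of_forall fun ω => ?_)
  by_cases h : L ω = optOrder K
  · simp [h]
  · simpa [h] using Finset.single_le_sum
      (f := fun σ => |expectedReward μ p (optOrder K) - expectedReward μ p σ|)
      (fun σ _ => abs_nonneg _) (Finset.mem_univ (L ω))

/-- An exploration slot is charged probability at most 1 of a wrong order, a later slot the failure
probability. Exploration may outlast the horizon; the count below `T` is still at most `N * K`. -/
theorem abs_regret_ecOrder_le {T : ℕ} {init commit : Ω → ArmOrder K}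
    (hinit : Measurable init) (hcommit : Measurable commit) :
    |regret P μ p (ecOrder μ p T init commit) T|
      ≤ (∑ σ, |expectedReward μ p (optOrder K) - expectedReward μ p σ|)
        * (exploreRounds μ p T * K + T * P.real {ω | commit ω ≠ optOrder K}) := by
  set M := ∑ σ, |expectedReward μ p (optOrder K) - expectedReward μ p σ| with hM
  set b := P.real {ω | commit ω ≠ optOrder K} with hb
  set n := exploreRounds μ p T * K with hn
  have hM0 : 0 ≤ M := Finset.sum_nonneg fun _ _ => abs_nonneg _
  have hb0 : 0 ≤ b := measureReal_nonneg
  have hslot : ∀ t, |∫ ω, (expectedReward μ p (optOrder K) -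
      expectedReward μ p (ecOrder μ p T init commit t ω)) ∂P|
      ≤ M * ((if t < n then 1 else 0) + b) := by
    intro t
    by_cases ht : t < n
    · have hm : Measurable fun ω => exploreOrder (init ω) t :=
        (measurable_from_top (f := fun σ => exploreOrder σ t)).comp hinit
      have := abs_integral_regret_le (P := P) (μ := μ) (p := p) hm
      simp only [ecOrder, ← hn, ht, if_true]
      refine this.trans (mul_le_mul_of_nonneg_left ?_ hM0)
      linarith [measureReal_le_one (μ := P) (s := {ω | exploreOrder (init ω) t ≠ optOrder K})]
    · simp only [ecOrder, ← hn, ht, if_false, zero_add]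
      exact abs_integral_regret_le hcommit
  calc |regret P μ p (ecOrder μ p T init commit) T|
      ≤ ∑ t ∈ Finset.range T, M * ((if t < n then 1 else 0) + b) :=
        (Finset.abs_sum_le_sum_abs _ _).trans (Finset.sum_le_sum fun t _ => hslot t)
    _ = M * (((Finset.range T).filter fun t => t < n).card + T * b) := by
        rw [← Finset.mul_sum, Finset.sum_add_distrib]
        simp
    _ ≤ M * (n + T * b) := by
        refine mul_le_mul_of_nonneg_left ?_ hM0
        have : ((Finset.range T).filter fun t => t < n).card ≤ n := by
          simpa using Finset.card_le_card (t := Finset.range n) fun t ht => by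
            simpa using (Finset.mem_filter.1 ht).2
        gcongr
    _ = _ := by
        rw [hn]
        push_cast
        rfl

end Probability

end CascadeBandit

end

theorem theorem2 {K : ℕ} (μ p : Fin K → ℝ)
    (hμ : ∀ i, 0 < μ i ∧ μ i ≤ 1) (hp : ∀ i, 0 ≤ p i ∧ p i ≤ 1) (hmono : StrictMono p) :
    ∃ C : ℝ, ∀ T : ℕ, 1 ≤ T →
      ∀ (Ω : Type*) [MeasurableSpace Ω] (P : MeasureTheory.Measure Ω)
        [MeasureTheory.IsProbabilityMeasure P]
        (X Y : ℕ → Fin K → Ω → Bool) (init commit : Ω → CascadeBandit.ArmOrder K),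
        CascadeBandit.IsEnvironment P μ p X Y →
        CascadeBandit.IsECRun P μ p X Y T init commit →
          P.real {ω | commit ω ≠ CascadeBandit.optOrder K}
              ≤ (K : ℝ) / (T : ℝ) ^ 2 + (K : ℝ) ^ 2 / (T : ℝ) ^ 4 ∧
          (2 ≤ T →
            |CascadeBandit.regret P μ p (CascadeBandit.ecOrder μ p T init commit) T|
              ≤ C * Real.log T) := by
  have hμ0 : ∀ i, 0 < μ i := fun i => (hμ i).1
  set M := ∑ σ, |CascadeBandit.expectedReward μ p (CascadeBandit.optOrder K)
    - CascadeBandit.expectedReward μ p σ| with hM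
  set A := ∑ i, 16 / (CascadeBandit.gap p i ^ 2 * μ i) with hA
  -- `A * K` comes from exploration. The constant `2K + K²` is `K` from rounding up `N` plus `K +
  -- K²` bounding `T` times the failure probability; `log T ≥ log 2` absorbs it.
  refine ⟨M * (A * K + (2 * K + K ^ 2) / Real.log 2),
    fun T hT Ω _ P _ X Y init commit henv hrun => ?_⟩
  have hcommit := CascadeBandit.prob_commit_ne_optOrder_le hμ0 hp hmono hT henv hrun
  refine ⟨hcommit, fun hT2 => ?_⟩
  refine (CascadeBandit.abs_regret_ecOrder_le hrun.measurable_init hrun.measurable_commit).trans ?_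
  have hM0 : 0 ≤ M := Finset.sum_nonneg fun _ _ => abs_nonneg _
  rw [mul_assoc]
  refine mul_le_mul_of_nonneg_left ?_ hM0
  have hT' : (1 : ℝ) ≤ T := by exact_mod_cast hT
  have hN := mul_le_mul_of_nonneg_right (CascadeBandit.exploreRounds_le (p := p) hμ0 T)
    (Nat.cast_nonneg K)
  have hc : (T : ℝ) * P.real {ω | commit ω ≠ CascadeBandit.optOrder K} ≤ K + K ^ 2 := by
    refine (mul_le_mul_of_nonneg_left hcommit (by positivity)).trans ?_
    rw [mul_add, mul_div_assoc', mul_div_assoc']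
    refine add_le_add ?_ ?_ <;> rw [div_le_iff₀ (by positivity), mul_comm] <;>
      refine mul_le_mul_of_nonneg_left ?_ (by positivity)
    · exact le_self_pow₀ hT' (by norm_num)
    · exact le_self_pow₀ hT' (by norm_num)
  have hlog2 : 0 < Real.log 2 := Real.log_pos one_lt_two
  have hlog : Real.log 2 ≤ Real.log T :=
    Real.log_le_log two_pos (by exact_mod_cast hT2)
  have hconst : (2 * K + K ^ 2 : ℝ) ≤ (2 * K + K ^ 2) / Real.log 2 * Real.log T := by
    rw [div_mul_eq_mul_div, le_div_iff₀ hlog2]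
    exact mul_le_mul_of_nonneg_left hlog (by positivity)
  linarith
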